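/- Let $\Gamma$ be a countable discrete group. Suppose that $\Gamma$ is ICC (the conjugacy class of every non-trivial element is infinite), inner-amenable (there is a probability measure on $\beta\Gamma\setminus\{e\}$, where $\beta\Gamma$ is the Stone–Čech compactification of $\Gamma$, that is invariant under the extension to $\beta\Gamma$ of the conjugation maps $x\mapsto gxg^{-1}$, $g\in\Gamma$), and non-amenable. Then $\Gamma$ does not have the (AO)-property. Here $\Gamma$ has the (AO)-property if the left-right representation of $\Gamma\times\Gamma$ in the Calkin algebra, $\lambda\times\rho : C^*(\Gamma\times\Gamma)\to \mathbb B(\ell^2\Gamma)/\mathbb K(\ell^2\Gamma)$, induced by $((\lambda\times\rho)(g,h)\xi)(x)=\xi(g^{-1}xh)$, is tempered, that is, factors through the canonical surjection $C^*(\Gamma\times\Gamma)\to C^*_\lambda(\Gamma\times\Gamma)$ onto the reduced group $C^*$-algebra. Equivalently: there is a unital $*$-homomorphism $\varphi : C^*_\lambda(\Gamma\times\Gamma)\to \mathbb B(\ell^2\Gamma)/\mathbb K(\ell^2\Gamma)$ that maps the canonical unitary of each $(g,h)\in\Gamma\times\Gamma$ to the class of $(\lambda\times\rho)(g,h)$.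 -/

import Mathlib

open MeasureTheory Filter
open scoped ENNReal Pointwise lp

noncomputable section

/-! ### Group-theoretic notions -/

/-- A group is ICC if the conjugacy class of every non-trivial element is infinite. -/
def IsICC (G : Type*) [Group G] : Prop :=
  ∀ g : G, g ≠ 1 → (conjugatesOf g).Infinite

/-- A discrete group is amenable if it carries a finitely additive, left-invariant probability
measure defined on all of its subsets. -/
def IsAmenableGroup (G : Type*) [Group G] : Prop :=
  ∃ m : Set G → ℝ, (∀ A, 0 ≤ m A) ∧ m Set.univ = 1 ∧
    (∀ A B, Disjoint A B → m (A ∪ B) = m A + m B) ∧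
    ∀ (g : G) (A : Set G), m (g • A) = m A

/-- `Ultrafilter X` is the Stone-Čech compactification of the discrete space `X`; we equip it with
its Borel sigma-algebra. -/
instance stoneCechMeasurableSpace (X : Type*) : MeasurableSpace (Ultrafilter X) := borel _

instance stoneCechBorelSpace (X : Type*) : BorelSpace (Ultrafilter X) := ⟨rfl⟩

/-- The extension of a self-map of `X` to the Stone-Čech compactification is continuous. -/
theorem continuous_ultrafilter_map {X Y : Type*} (f : X → Y) :
    Continuous (Ultrafilter.map f : Ultrafilter X → Ultrafilter Y) := by
  refine (ultrafilterBasis_is_basis (α := Y)).continuous_iff.2 ?_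
  rintro _ ⟨s, rfl⟩
  exact ultrafilter_isOpen_basic (f ⁻¹' s)

/-- A discrete group is inner-amenable if there is a (regular Borel) probability measure on its
Stone-Čech compactification minus the point `e` (i.e. not charging the principal ultrafilter at
`e`), which is invariant for the extension of the adjoint action `x ↦ g * x * g⁻¹`. -/
def IsInnerAmenable (G : Type*) [Group G] : Prop :=
  ∃ μ : Measure (Ultrafilter G), IsProbabilityMeasure μ ∧ μ.Regular ∧
    μ {(pure 1 : Ultrafilter G)} = 0 ∧
    ∀ g : G, μ.map (Ultrafilter.map fun x => g * x * g⁻¹) = μ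

/-! ### Permutation representations on `ℓ²` -/

/-- Summable-square families are stable under relabelling of the indices. -/
theorem memℓp_comp_perm {X : Type*} (σ : Equiv.Perm X) {f : X → ℂ} (hf : Memℓp f 2) :
    Memℓp (fun x => f (σ x)) 2 := by
  rw [memℓp_gen_iff (by norm_num)] at hf ⊢
  exact σ.summable_iff.2 hf

/-- The isometry `ξ ↦ ξ ∘ σ⁻¹` of `ℓ²(X)`. -/
def permIsometry {X : Type*} (σ : Equiv.Perm X) : ℓ²(X, ℂ) →ₗᵢ[ℂ] ℓ²(X, ℂ) where
  toFun ξ := ⟨fun x => ξ (σ⁻¹ x), memℓp_comp_perm σ⁻¹ (lp.memℓp ξ)⟩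
  map_add' _ _ := rfl
  map_smul' _ _ := rfl
  norm_map' ξ := by
    have h : (0 : ℝ) < (2 : ℝ≥0∞).toReal := by norm_num
    change ‖(⟨fun x => ξ (σ⁻¹ x), memℓp_comp_perm σ⁻¹ (lp.memℓp ξ)⟩ : ℓ²(X, ℂ))‖ = ‖ξ‖
    rw [lp.norm_eq_tsum_rpow h, lp.norm_eq_tsum_rpow h]
    exact congrArg (· ^ (1 / (2 : ℝ≥0∞).toReal))
      (Equiv.tsum_eq σ⁻¹ fun x => ‖ξ x‖ ^ (2 : ℝ≥0∞).toReal)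

/-- The permutation representation of `Equiv.Perm X` on `ℓ²(X)`:
`(permRep σ ξ) x = ξ (σ⁻¹ x)`. -/
def permRep (X : Type*) : Equiv.Perm X →* (ℓ²(X, ℂ) →L[ℂ] ℓ²(X, ℂ)) where
  toFun σ := (permIsometry σ).toContinuousLinearMap
  map_one' := rfl
  map_mul' _ _ := rfl

/-- The left regular representation: `(leftRegular G g ξ) x = ξ (g⁻¹ * x)`. -/
def leftRegular (G : Type*) [Group G] : G →* (ℓ²(G, ℂ) →L[ℂ] ℓ²(G, ℂ)) :=
  (permRep G).comp (MulAction.toPermHom G G)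

/-- The left-right action of `G × G` on `G`: `(g, h)` acts as `x ↦ g * x * h⁻¹`. -/
def leftRightPerm (G : Type*) [Group G] : G × G →* Equiv.Perm G where
  toFun p :=
    { toFun := fun x => p.1 * x * p.2⁻¹
      invFun := fun x => p.1⁻¹ * x * p.2
      left_inv := fun x => by group
      right_inv := fun x => by group }
  map_one' := by ext x; simp
  map_mul' p q := by ext x; simp [mul_assoc]

/-- The left-right representation `λ × ρ` of `G × G` on `ℓ²(G)`:
`(leftRightRep G (g, h) ξ) x = ξ (g⁻¹ * x * h)`. -/
def leftRightRep (G : Type*) [Group G] : G × G →* (ℓ²(G, ℂ) →L[ℂ] ℓ²(G, ℂ)) :=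
  (permRep G).comp (leftRightPerm G)

/-! ### The Calkin algebra -/

section Calkin

variable (H : Type*) [NormedAddCommGroup H] [InnerProductSpace ℂ H]

/-- The ideal `K(H)` of compact operators in `B(H)`. -/
def compactIdeal : Ideal (H →L[ℂ] H) where
  carrier := {T | IsCompactOperator T}
  add_mem' hS hT := hS.add hT
  zero_mem' := isCompactOperator_zero
  smul_mem' S _ hT := hT.clm_comp S

instance compactIdeal_isTwoSided : (compactIdeal H).IsTwoSided where
  mul_mem_of_left S hT := IsCompactOperator.comp_clm hT S

/-- The Calkin algebra `B(H) / K(H)`. -/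
abbrev Calkin : Type _ := (H →L[ℂ] H) ⧸ compactIdeal H

variable [CompleteSpace H]

/-- The adjoint of a compact operator on a Hilbert space is compact. -/
theorem isCompactOperator_star {T : H →L[ℂ] H} (hT : IsCompactOperator T) :
    IsCompactOperator (star T : H →L[ℂ] H) := by
  set S : H →L[ℂ] H := star T with hS
  have hTS : IsCompactOperator (T ∘L S) := hT.comp_clm S
  have htb : TotallyBounded ((T ∘L S) '' Metric.ball 0 1) :=
    ((isCompactOperator_iff_isCompact_closure_image_ball (T ∘L S).toLinearMap
      one_pos).1 hTS).totallyBounded.subset subset_closure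
  refine (isCompactOperator_iff_isCompact_closure_image_ball S.toLinearMap one_pos).2 ?_
  refine TotallyBounded.isCompact_of_isClosed (TotallyBounded.closure ?_) isClosed_closure
  rw [Metric.totallyBounded_iff]
  intro ε hε
  obtain ⟨u, hu, hufin, ht⟩ := Set.exists_subset_image_finite_and.1
    (totallyBounded_iff_subset.1 htb _ (Metric.dist_mem_uniformity (half_pos (pow_pos hε 2))))
  refine ⟨S '' u, hufin.image _, ?_⟩
  rintro _ ⟨x, hx, rfl⟩
  obtain ⟨_, ⟨y, hy, rfl⟩, hxy⟩ := Set.mem_iUnion₂.1 (ht ⟨x, hx, rfl⟩)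
  refine Set.mem_iUnion₂.2 ⟨S y, ⟨y, hy, rfl⟩, ?_⟩
  have hx1 : ‖x‖ < 1 := by simpa using hx
  have hy1 : ‖y‖ < 1 := by simpa using hu hy
  have hd : ‖T (S (x - y))‖ < ε ^ 2 / 2 := by
    simpa [dist_eq_norm] using hxy
  have h2 : ‖x - y‖ ≤ 2 := (norm_sub_le x y).trans (by linarith)
  have key : ‖S (x - y)‖ ^ 2 = RCLike.re (inner ℂ (T (S (x - y))) (x - y)) := by
    rw [← ContinuousLinearMap.adjoint_inner_right, ← ContinuousLinearMap.star_eq_adjoint, ← hS,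
      inner_self_eq_norm_sq]
  have hb : ‖S (x - y)‖ ^ 2 < ε ^ 2 := by
    rw [key]
    calc RCLike.re (inner ℂ (T (S (x - y))) (x - y))
        ≤ ‖T (S (x - y))‖ * ‖x - y‖ := re_inner_le_norm _ _
      _ ≤ ‖T (S (x - y))‖ * 2 := by gcongr
      _ < ε ^ 2 := by linarith
  have := lt_of_pow_lt_pow_left₀ 2 hε.le hb
  simpa [dist_eq_norm] using this

/-- The involution of the Calkin algebra, induced by the adjoint. -/
instance calkinStarRing : StarRing (Calkin H) where
  star := Quotient.map star (by
    intro S T hST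
    refine (Submodule.quotientRel_def _).2 ?_
    rw [← star_sub]
    exact isCompactOperator_star H ((Submodule.quotientRel_def _).1 hST))
  star_involutive := by
    rintro ⟨T⟩
    exact congrArg (Ideal.Quotient.mk (compactIdeal H)) (star_star T)
  star_mul := by
    rintro ⟨S⟩ ⟨T⟩
    exact congrArg (Ideal.Quotient.mk (compactIdeal H)) (star_mul S T)
  star_add := by
    rintro ⟨S⟩ ⟨T⟩
    exact congrArg (Ideal.Quotient.mk (compactIdeal H)) (star_add S T)

end Calkin

/-- The representation of `G × G` in the Calkin algebra of `ℓ²(G)` induced by `λ × ρ`. -/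
def calkinLeftRightRep (G : Type*) [Group G] : G × G →* Calkin ℓ²(G, ℂ) :=
  (Ideal.Quotient.mk (compactIdeal ℓ²(G, ℂ)) : _ →* Calkin ℓ²(G, ℂ)).comp (leftRightRep G)

/-! ### Temperedness and the (AO)-property -/

/-- The reduced group `C*`-algebra: the norm closure in `B(ℓ²(G))` of the `*`-algebra generated by
the left regular representation. -/
def reducedCStar (G : Type*) [Group G] : StarSubalgebra ℂ (ℓ²(G, ℂ) →L[ℂ] ℓ²(G, ℂ)) :=
  (StarAlgebra.adjoin ℂ (Set.range (leftRegular G))).topologicalClosure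

/-- The canonical unitaries of the reduced group `C*`-algebra. -/
def reducedUnitary {G : Type*} [Group G] (g : G) : reducedCStar G :=
  ⟨leftRegular G g, StarSubalgebra.le_topologicalClosure _
    (StarAlgebra.subset_adjoin ℂ _ ⟨g, rfl⟩)⟩

/-- A representation `π` of `G` by unitaries of a unital `C*`-algebra `A` is tempered if the
associated `*`-homomorphism `C*(G) → A` factors through the canonical surjection of `C*(G)` onto
the reduced group `C*`-algebra, i.e. if there is a `*`-homomorphism from the latter to `A` sending
the canonical unitary of each `g` to `π g`. -/
def IsTempered {G A : Type*} [Group G] [Ring A] [StarRing A] [Algebra ℂ A] (π : G →* A) : Prop :=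
  ∃ φ : reducedCStar G →⋆ₐ[ℂ] A, ∀ g : G, φ (reducedUnitary g) = π g

/-- The (AO)-property: the left-right representation of `G × G` in the Calkin algebra of `ℓ²(G)`
is tempered. -/
def HasAOProperty (G : Type*) [Group G] : Prop :=
  IsTempered (calkinLeftRightRep G)

end

/-!
An inner amenable group carries a conjugation-invariant mean that does not charge the identity, and
in an ICC group such a mean vanishes on finite sets. Day's convexity trick turns it into unit
vectors `ξ ∈ ℓ²(Γ)`, supported off any prescribed finite set, that are almost fixed by the
operators `(λ × ρ)(g, g)` (`exists_almost_invariant_unit_vector`). Along such vectors compact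
operators tend to zero, so in effect they define a state on the Calkin algebra taking the value `1`
at the class of each `(λ × ρ)(g, g)`.

If the left-right representation in the Calkin algebra is tempered, this state pulls back to the
reduced `C*`-algebra of `Γ × Γ`, so that the trivial representation of the diagonal subgroup is
weakly contained in the restriction of the regular representation of `Γ × Γ`. Quantitatively,
`‖∑ g ∈ S, λ (g, g)‖` equals the cardinality of `S` for every finite `S`
(`IsTempered.card_le_norm_sum`). As in Kesten's criterion, uniform convexity then produces almost
invariant unit vectors in `ℓ²(Γ × Γ)` (`exists_almost_fixed_unit_vector`), and pushing the densities
`‖ξ‖²` forward along the first coordinate gives a left-invariant mean on `Γ`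
(`isAmenableGroup_of_almost_invariant`): the group is amenable.
-/

/-! ### Almost invariant vectors from invariant measures on the Stone-Čech compactification -/

theorem Ultrafilter.exists_continuous_extension {X : Type*} (f : X → ℝ) (M : ℝ)
    (hf : ∀ x, |f x| ≤ M) :
    ∃ g : Ultrafilter X → ℝ, Continuous g ∧ ∀ U : Ultrafilter X, Tendsto f U (nhds (g U)) := by
  let f' : X → Set.Icc (-M) M := fun x => ⟨f x, abs_le.1 (hf x)⟩
  refine ⟨fun U => ((Ultrafilter.extend f' U : Set.Icc (-M) M) : ℝ),
    continuous_subtype_val.comp (continuous_ultrafilter_extend f'), fun U => ?_⟩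
  have h : Tendsto f' U (nhds (Ultrafilter.extend f' U)) :=
    ultrafilter_extend_eq_iff.1 rfl
  exact (continuous_subtype_val.tendsto _).comp h

/-- A function of the form `f ∘ σ - f`, and hence any finite sum of such functions, has mean zero
for an invariant mean; so it cannot be bounded below by a positive constant off a null set. -/
theorem exists_sum_comp_sub_lt {X ι : Type*} [Fintype ι] (μ : Measure (Ultrafilter X))
    [IsProbabilityMeasure μ] (σ : ι → X → X)
    (hσ : ∀ i, μ.map (Ultrafilter.map (σ i)) = μ) {F : Set X}
    (hF : μ {U | F ∈ U} = 0) (f : ι → X → ℝ) (M : ι → ℝ) (hf : ∀ i x, |f i x| ≤ M i)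
    {u : ℝ} (hu : 0 < u) : ∃ x ∉ F, ∑ i, (f i (σ i x) - f i x) < u := by
  by_contra! h
  choose g hgc hg using fun i => Ultrafilter.exists_continuous_extension (f i) (M i) (hf i)
  have hint : ∀ k : Ultrafilter X → ℝ, Continuous k → Integrable k μ := fun k hk =>
    hk.integrable_of_hasCompactSupport (HasCompactSupport.of_compactSpace k)
  have hcomp : ∀ i, Continuous fun U => g i (Ultrafilter.map (σ i) U) := fun i =>
    (hgc i).comp (continuous_ultrafilter_map (σ i))
  have hzero : ∫ U, ∑ i, (g i (Ultrafilter.map (σ i) U) - g i U) ∂μ = 0 := by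
    rw [integral_finsetSum Finset.univ
      (f := fun i U => g i (Ultrafilter.map (σ i) U) - g i U)
      fun i _ => hint _ ((hcomp i).sub (hgc i))]
    refine Finset.sum_eq_zero fun i _ => ?_
    rw [integral_sub (hint _ (hcomp i)) (hint _ (hgc i)), sub_eq_zero,
      ← integral_map (continuous_ultrafilter_map (σ i)).aemeasurable
        (hgc i).aestronglyMeasurable, hσ i]
  have hae : ∀ᵐ U ∂μ, u ≤ ∑ i, (g i (Ultrafilter.map (σ i) U) - g i U) := by
    have hF' : ∀ᵐ U ∂μ, ¬ F ∈ U := by simpa [ae_iff] using hF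
    filter_upwards [hF'] with U hU
    have ht : Tendsto (fun x => ∑ i, (f i (σ i x) - f i x)) U
        (nhds (∑ i, (g i (Ultrafilter.map (σ i) U) - g i U))) :=
      tendsto_finsetSum _ fun i _ =>
        (Tendsto.comp (hg i (Ultrafilter.map (σ i) U)) tendsto_map).sub (hg i U)
    refine ge_of_tendsto ht ?_
    filter_upwards [Ultrafilter.compl_mem_iff_notMem.2 hU] with x hx using h x hx
  have : ∫ _ : Ultrafilter X, u ∂μ ≤ ∫ U, ∑ i, (g i (Ultrafilter.map (σ i) U) - g i U) ∂μ :=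
    integral_mono_ae (integrable_const u)
      (hint _ (continuous_finsetSum _ fun i _ => (hcomp i).sub (hgc i))) hae
  rw [hzero] at this
  simp at this
  linarith

/-- Day's convexity argument: if the almost invariance defects of the probability densities
supported off `F` stayed away from `0` in `ℓ¹`, a separating functional would contradict
`exists_sum_comp_sub_lt`. -/
theorem exists_almost_invariant_density {X ι : Type*} [Fintype ι] (μ : Measure (Ultrafilter X))
    [IsProbabilityMeasure μ] (σ : ι → Equiv.Perm X)
    (hσ : ∀ i, μ.map (Ultrafilter.map (σ i)) = μ) {F : Set X}
    (hF : μ {U | F ∈ U} = 0) {ε : ℝ} (hε : 0 < ε) :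
    ∃ w : X →₀ ℝ, (∀ x, 0 ≤ w x) ∧ (∑ x ∈ w.support, w x = 1) ∧ (∀ x ∈ F, w x = 0) ∧
      ∀ i, ∃ s < ε, HasSum (fun y => |w ((σ i)⁻¹ y) - w y|) s := by
  classical
  -- `L w` is the family of the defects `(σ i)_* w - w`, and `C` the set of densities off `F`.
  let δ : X → lp (fun _ : X => ℝ) 1 := fun x => lp.single 1 x (1 : ℝ)
  let L : (X →₀ ℝ) →ₗ[ℝ] (ι → lp (fun _ : X => ℝ) 1) :=
    Finsupp.linearCombination ℝ fun x i => δ (σ i x) - δ x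
  have hL : ∀ w i y, L w i y = w ((σ i)⁻¹ y) - w y := by
    intro w i y
    induction w using Finsupp.induction_linear with
    | zero => simp [L]
    | add v w hv hw =>
      simp only [map_add, Pi.add_apply, lp.coeFn_add, hv, hw, Finsupp.add_apply]
      ring
    | single x a =>
      simp only [L, δ, Finsupp.linearCombination_single, Pi.smul_apply, lp.coeFn_smul,
        lp.coeFn_sub, Pi.sub_apply, lp.single_apply, Finsupp.single_apply, smul_eq_mul,
        Pi.single_apply, mul_sub, mul_ite, mul_one, mul_zero, Equiv.Perm.eq_inv_iff_eq,
        eq_comm (a := y)]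
  let C : Set (X →₀ ℝ) :=
    {w | (∀ x, 0 ≤ w x) ∧ Finsupp.linearCombination ℝ (fun _ => (1 : ℝ)) w = 1 ∧ ∀ x ∈ F, w x = 0}
  have hC : Convex ℝ C := by
    rintro v ⟨hv0, hv1, hvF⟩ w ⟨hw0, hw1, hwF⟩ a b ha hb hab
    refine ⟨fun x => ?_, ?_, fun x hx => ?_⟩
    · simpa using add_nonneg (mul_nonneg ha (hv0 x)) (mul_nonneg hb (hw0 x))
    · simp [map_add, map_smul, hv1, hw1, hab]
    · simp [hvF x hx, hwF x hx]
  have h0 : (0 : ι → lp (fun _ : X => ℝ) 1) ∈ closure (L '' C) := by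
    by_contra h0
    obtain ⟨Φ, u, hu, hΦ⟩ :=
      geometric_hahn_banach_point_closed (hC.linear_image L).closure isClosed_closure h0
    rw [map_zero] at hu
    let f : ι → X → ℝ := fun i x => Φ (Pi.single i (δ x))
    have hf : ∀ i x, |f i x| ≤ ‖Φ‖ := fun i x => by
      have h1 : ‖δ x‖ = 1 := by simp [δ, lp.norm_single]
      simpa [Pi.norm_single, h1] using Φ.le_opNorm (Pi.single i (δ x))
    obtain ⟨x, hx, hlt⟩ := exists_sum_comp_sub_lt μ (fun i => σ i) hσ hF f (fun _ => ‖Φ‖) hf hu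
    have hmem : Finsupp.single x (1 : ℝ) ∈ C := by
      refine ⟨fun y => ?_, by simp, fun y hy => Finsupp.single_eq_of_ne ?_⟩
      · rw [Finsupp.single_apply]; split_ifs <;> norm_num
      · rintro rfl; exact hx hy
    have hb := hΦ _ (subset_closure ⟨_, hmem, rfl⟩)
    have he : Φ (L (Finsupp.single x 1)) = ∑ i, (f i (σ i x) - f i x) := by
      have : L (Finsupp.single x 1) = ∑ i, Pi.single i (δ (σ i x) - δ x) := by
        rw [Finset.univ_sum_single]
        simp [L]
      simp only [this, map_sum, f, Pi.single_sub, map_sub]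
    linarith
  obtain ⟨_, ⟨w, ⟨hw0, hw1, hwF⟩, rfl⟩, hw⟩ := Metric.mem_closure_iff.1 h0 ε hε
  refine ⟨w, hw0, by simpa [Finsupp.linearCombination_apply, Finsupp.sum] using hw1, hwF,
    fun i => ⟨‖L w i‖, ?_, ?_⟩⟩
  · rw [dist_zero_left] at hw
    exact (norm_le_pi_norm (L w) i).trans_lt hw
  · have := lp.hasSum_norm (p := 1) (by norm_num) (L w i)
    simpa [hL] using this

theorem sq_sqrt_sub_sqrt_le {a b : ℝ} (ha : 0 ≤ a) (hb : 0 ≤ b) : (√a - √b) ^ 2 ≤ |a - b| := by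
  have h : a - b = (√a - √b) * (√a + √b) := by
    nlinarith [Real.sq_sqrt ha, Real.sq_sqrt hb]
  rw [h, abs_mul, ← sq_abs, sq]
  refine mul_le_mul_of_nonneg_left ?_ (abs_nonneg _)
  rw [abs_of_nonneg (add_nonneg (Real.sqrt_nonneg a) (Real.sqrt_nonneg b)), abs_le]
  constructor <;> linarith [Real.sqrt_nonneg a, Real.sqrt_nonneg b]

/-- The square roots of almost invariant densities are almost invariant unit vectors of `ℓ²`. -/
theorem exists_almost_invariant_unit_vector {X ι : Type*} [Fintype ι]
    (μ : Measure (Ultrafilter X)) [IsProbabilityMeasure μ] (σ : ι → Equiv.Perm X)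
    (hσ : ∀ i, μ.map (Ultrafilter.map (σ i)) = μ) {F : Set X}
    (hF : μ {U | F ∈ U} = 0) {ε : ℝ} (hε : 0 < ε) :
    ∃ ξ : ℓ²(X, ℂ), ‖ξ‖ = 1 ∧ (∀ x ∈ F, ξ x = 0) ∧ ∀ i, ‖permRep X (σ i) ξ - ξ‖ < ε := by
  obtain ⟨w, hw0, hw1, hwF, hw⟩ :=
    exists_almost_invariant_density μ σ hσ hF (ε := ε ^ 2) (by positivity)
  have hsq : ∀ x, ‖((√(w x) : ℝ) : ℂ)‖ ^ (2 : ℝ≥0∞).toReal = w x := fun x => by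
    simp [Complex.norm_real, Real.sq_sqrt (hw0 x)]
  have hsum : HasSum w 1 := by
    rw [← hw1]
    exact hasSum_sum_of_ne_finset_zero fun x hx => Finsupp.notMem_support_iff.1 hx
  let ξ : ℓ²(X, ℂ) := ⟨fun x => ((√(w x) : ℝ) : ℂ),
    (memℓp_gen_iff (by norm_num)).2 (by simpa only [hsq] using hsum.summable)⟩
  refine ⟨ξ, ?_, fun x hx => by simp [ξ, hwF x hx], fun i => ?_⟩
  · have h := lp.hasSum_norm (p := 2) (by norm_num) ξ
    have h1 := h.unique (by simpa only [ξ, hsq] using hsum)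
    simpa [pow_eq_one_iff_of_nonneg] using h1
  · obtain ⟨s, hs, hsw⟩ := hw i
    have h := lp.hasSum_norm (p := 2) (by norm_num) (permRep X (σ i) ξ - ξ)
    have hle := hasSum_le (fun y => ?_) h hsw
    · refine lt_of_pow_lt_pow_left₀ 2 hε.le (lt_of_le_of_lt ?_ hs)
      simpa using hle
    · change ‖((√(w ((σ i)⁻¹ y)) : ℝ) : ℂ) - ((√(w y) : ℝ) : ℂ)‖ ^ (2 : ℝ≥0∞).toReal ≤ _
      rw [← Complex.ofReal_sub, Complex.norm_real, Real.norm_eq_abs]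
      simpa using sq_sqrt_sub_sqrt_le (hw0 _) (hw0 _)

/-! ### Compact perturbations and vectors supported off a large finite set -/

/-- A compact operator is small in the weak sense on unit vectors supported off a suitable finite
set. -/
theorem IsCompactOperator.exists_finset_norm_inner_le {X : Type*}
    {K : ℓ²(X, ℂ) →L[ℂ] ℓ²(X, ℂ)} (hK : IsCompactOperator K) {ε : ℝ} (hε : 0 < ε) :
    ∃ F : Finset X, ∀ ξ : ℓ²(X, ℂ), ‖ξ‖ = 1 → (∀ x ∈ F, ξ x = 0) → ‖inner ℂ (K ξ) ξ‖ < ε := by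
  classical
  have htb : TotallyBounded (K '' Metric.closedBall 0 1) :=
    ((isCompactOperator_iff_isCompact_closure_image_closedBall K.toLinearMap
      one_pos).1 hK).totallyBounded.subset subset_closure
  obtain ⟨t, ht, hcov⟩ := Metric.totallyBounded_iff.1 htb (ε / 2) (half_pos hε)
  have happrox : ∀ y : ℓ²(X, ℂ), ∃ s : Finset X, dist (∑ x ∈ s, lp.single 2 x (y x)) y < ε / 2 :=
    fun y => (Metric.tendsto_atTop.1 (lp.hasSum_single (by norm_num) y) (ε / 2)
      (half_pos hε)).imp fun s hs => hs s le_rfl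
  choose s hs using happrox
  refine ⟨ht.toFinset.biUnion s, fun ξ hξ hF => ?_⟩
  obtain ⟨y, hy, hKy⟩ := Set.mem_iUnion₂.1 (hcov ⟨ξ, by simp [hξ], rfl⟩)
  rw [Metric.mem_ball, dist_eq_norm] at hKy
  have hys := hs y
  rw [dist_comm, dist_eq_norm] at hys
  set z : ℓ²(X, ℂ) := ∑ x ∈ s y, lp.single 2 x (y x)
  have hz : inner ℂ z ξ = 0 := by
    rw [sum_inner]
    refine Finset.sum_eq_zero fun x hx => ?_
    rw [lp.inner_single_left, hF x (Finset.mem_biUnion.2 ⟨y, ht.mem_toFinset.2 hy, hx⟩),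
      inner_zero_right]
  calc ‖inner ℂ (K ξ) ξ‖ = ‖inner ℂ (K ξ - z) ξ‖ := by rw [inner_sub_left, hz, sub_zero]
    _ ≤ ‖K ξ - z‖ * ‖ξ‖ := norm_inner_le_norm _ _
    _ = ‖(K ξ - y) + (y - z)‖ := by rw [hξ, mul_one, sub_add_sub_cancel]
    _ ≤ ‖K ξ - y‖ + ‖y - z‖ := norm_add_le _ _
    _ < ε := by linarith

theorem CStarAlgebra.exists_star_mul_self_add_eq {A : Type*} [CStarAlgebra A] (a : A) :
    ∃ c : A, star a * a + star c * c = algebraMap ℂ A ((‖a‖ ^ 2 : ℝ) : ℂ) := by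
  let _ : PartialOrder A := CStarAlgebra.spectralOrder A
  have : StarOrderedRing A := CStarAlgebra.spectralOrderedRing A
  obtain ⟨c, hc⟩ := CStarAlgebra.nonneg_iff_eq_star_mul_self.1
    (sub_nonneg.2 (CStarAlgebra.star_mul_le_algebraMap_norm_sq (a := a)))
  refine ⟨c, ?_⟩
  rw [← hc, add_sub_cancel]
  rw [Algebra.algebraMap_eq_smul_one, Algebra.algebraMap_eq_smul_one, Complex.coe_smul]

/-- A `*`-homomorphism into the Calkin algebra is contractive: on unit vectors supported off a
large finite set, any lift `T` of `φ a` is bounded by `‖a‖`, up to a small error.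
Writing `‖a‖² - a* a = c* c` exhibits `‖a‖² - T* T` as a positive operator up to a compact one, so
no norm on the Calkin algebra is needed. -/
theorem exists_finset_norm_apply_sq_lt {A X : Type*} [CStarAlgebra A]
    (φ : A →⋆ₐ[ℂ] Calkin ℓ²(X, ℂ)) (a : A) (T : ℓ²(X, ℂ) →L[ℂ] ℓ²(X, ℂ))
    (hT : φ a = Ideal.Quotient.mk (compactIdeal ℓ²(X, ℂ)) T) {ε : ℝ} (hε : 0 < ε) :
    ∃ F : Finset X, ∀ ξ : ℓ²(X, ℂ), ‖ξ‖ = 1 → (∀ x ∈ F, ξ x = 0) →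
      ‖T ξ‖ ^ 2 < ‖a‖ ^ 2 + ε := by
  obtain ⟨c, hc⟩ := CStarAlgebra.exists_star_mul_self_add_eq a
  obtain ⟨R, hR⟩ := Ideal.Quotient.mk_surjective (φ c)
  set r : ℂ := ((‖a‖ ^ 2 : ℝ) : ℂ) with hr
  have hK : IsCompactOperator
      (star T * T + star R * R - algebraMap ℂ (ℓ²(X, ℂ) →L[ℂ] ℓ²(X, ℂ)) r) := by
    change _ ∈ compactIdeal ℓ²(X, ℂ)
    have hφ : star (φ a) * φ a + star (φ c) * φ c = algebraMap ℂ (Calkin ℓ²(X, ℂ)) r := by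
      rw [← map_star, ← map_star, ← map_mul, ← map_mul, ← map_add, hc, AlgHomClass.commutes]
    rw [hT, ← hR] at hφ
    exact Ideal.Quotient.eq.1 hφ
  obtain ⟨F, hF⟩ := hK.exists_finset_norm_inner_le hε
  refine ⟨F, fun ξ hξ hξF => ?_⟩
  have h := (Complex.abs_re_le_norm _).trans_lt (hF ξ hξ hξF)
  have hre : (inner ℂ ((star T * T + star R * R -
      algebraMap ℂ (ℓ²(X, ℂ) →L[ℂ] ℓ²(X, ℂ)) r) ξ) ξ).re = ‖T ξ‖ ^ 2 + ‖R ξ‖ ^ 2 - ‖a‖ ^ 2 := by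
    simp only [sub_apply, add_apply,
      mul_apply_eq_comp, ContinuousLinearMap.star_eq_adjoint,
      Algebra.algebraMap_eq_smul_one, smul_apply,
      one_apply_eq_self, inner_sub_left, inner_add_left,
      ContinuousLinearMap.adjoint_inner_left, inner_smul_left, inner_self_eq_norm_sq_to_K, hξ, hr,
      Complex.conj_ofReal]
    norm_cast
    simp [← Complex.ofReal_pow]
  rw [hre] at h
  nlinarith [(abs_lt.1 h).2, sq_nonneg ‖R ξ‖]

theorem card_le_norm_sum_add {ι E : Type*} [NormedAddCommGroup E] [NormedSpace ℝ E]
    (S : Finset ι) (v : ι → E)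
    {ξ : E} (hξ : ‖ξ‖ = 1) {δ : ℝ} (hv : ∀ p ∈ S, ‖v p - ξ‖ ≤ δ / (S.card + 1)) (hδ : 0 ≤ δ) :
    (S.card : ℝ) ≤ ‖∑ p ∈ S, v p‖ + δ := by
  have h1 : ∑ p ∈ S, v p - (S.card : ℝ) • ξ = ∑ p ∈ S, (v p - ξ) := by
    simp [Finset.sum_sub_distrib, ← Nat.cast_smul_eq_nsmul ℝ]
  have h2 : ‖∑ p ∈ S, v p - (S.card : ℝ) • ξ‖ ≤ δ := by
    rw [h1]
    refine (norm_sum_le_of_le S hv).trans ?_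
    rw [Finset.sum_const, nsmul_eq_mul, mul_div_assoc', div_le_iff₀ (by positivity)]
    nlinarith
  have h3 : ‖(S.card : ℝ) • ξ‖ = S.card := by simp [norm_smul, hξ]
  have h4 := norm_sub_norm_le ((S.card : ℝ) • ξ) (∑ p ∈ S, v p)
  rw [norm_sub_rev, h3] at h4
  linarith

theorem norm_sum_reducedUnitary {G : Type*} [Group G] (S : Finset G) :
    ‖∑ g ∈ S, reducedUnitary g‖ = ‖∑ g ∈ S, leftRegular G g‖ := by
  change ‖((∑ g ∈ S, reducedUnitary g : reducedCStar G) : ℓ²(G, ℂ) →L[ℂ] ℓ²(G, ℂ))‖ = _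
  rw [AddSubmonoidClass.coe_finsetSum]
  rfl

/-- If a tempered left-right representation in the Calkin algebra has almost invariant unit vectors
supported off every finite set, then the regular representation has no spectral gap either. -/
theorem IsTempered.card_le_norm_sum {G : Type*} [Group G]
    (hG : IsTempered (calkinLeftRightRep G)) (S : Finset (G × G))
    (hS : ∀ (F : Finset G) (ε : ℝ), 0 < ε → ∃ ξ : ℓ²(G, ℂ), ‖ξ‖ = 1 ∧ (∀ x ∈ F, ξ x = 0) ∧
      ∀ p ∈ S, ‖leftRightRep G p ξ - ξ‖ < ε) :
    (S.card : ℝ) ≤ ‖∑ p ∈ S, leftRegular (G × G) p‖ := by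
  obtain ⟨φ, hφ⟩ := hG
  have : IsClosed (reducedCStar (G × G) : Set (ℓ²(G × G, ℂ) →L[ℂ] ℓ²(G × G, ℂ))) :=
    StarSubalgebra.isClosed_topologicalClosure _
  have hT : φ (∑ p ∈ S, reducedUnitary p) =
      Ideal.Quotient.mk (compactIdeal ℓ²(G, ℂ)) (∑ p ∈ S, leftRightRep G p) := by
    rw [map_sum, map_sum]
    exact Finset.sum_congr rfl fun p _ => hφ p
  rw [← norm_sum_reducedUnitary]
  refine le_of_forall_pos_le_add fun δ hδ => ?_
  have hδ2 : 0 < δ / 2 := half_pos hδ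
  obtain ⟨F, hF⟩ := exists_finset_norm_apply_sq_lt φ _ _ hT (sq_pos_of_pos hδ2)
  obtain ⟨ξ, hξ, hξF, hinv⟩ := hS F (δ / 2 / (S.card + 1)) (by positivity)
  have h1 : ‖(∑ p ∈ S, leftRightRep G p) ξ‖ < ‖∑ p ∈ S, reducedUnitary p‖ + δ / 2 :=
    lt_of_pow_lt_pow_left₀ 2 (add_nonneg (norm_nonneg _) hδ2.le)
      ((hF ξ hξ hξF).trans_le (pow_add_pow_le (norm_nonneg _) hδ2.le two_ne_zero))
  have h2 := card_le_norm_sum_add S (fun p => leftRightRep G p ξ) hξ (fun p hp => (hinv p hp).le)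
    hδ2.le
  rw [sum_apply] at h1
  linarith

/-! ### Amenability from the absence of a spectral gap -/

/-- If a sum of isometries, one of them the identity, has the largest possible norm, then the
isometries have common almost fixed vectors: by uniform convexity, the terms of an almost
norm-attaining sum are close to each other. -/
theorem exists_almost_fixed_unit_vector {ι H : Type*} [NormedAddCommGroup H]
    [InnerProductSpace ℂ H] (S : Finset ι) (u : ι → H →L[ℂ] H) (hu : ∀ i ξ, ‖u i ξ‖ = ‖ξ‖)
    {e : ι} (he : e ∈ S) (hue : u e = 1) (hS : (S.card : ℝ) ≤ ‖∑ i ∈ S, u i‖)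
    {ε : ℝ} (hε : 0 < ε) : ∃ ξ : H, ‖ξ‖ = 1 ∧ ∀ i ∈ S, ‖u i ξ - ξ‖ < ε := by
  classical
  -- A norm defect `η` forces `‖u i ξ + ξ‖ > 2 - η`, hence `‖u i ξ - ξ‖ ^ 2 < 4 * η`.
  obtain ⟨η, hη0, hη1, hηε⟩ : ∃ η : ℝ, 0 < η ∧ η ≤ 1 ∧ 4 * η < ε ^ 2 :=
    ⟨min 1 (ε ^ 2 / 8), by positivity, min_le_left _ _, by
      have := min_le_right 1 (ε ^ 2 / 8)
      nlinarith [sq_pos_of_pos hε]⟩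
  have hcard : (1 : ℝ) ≤ S.card := by exact_mod_cast Finset.card_pos.2 ⟨e, he⟩
  obtain ⟨ξ, hξ, hlt⟩ : ∃ ξ : H, ‖ξ‖ = 1 ∧ S.card - η < ‖(∑ i ∈ S, u i) ξ‖ := by
    by_contra! h
    have := ContinuousLinearMap.opNorm_le_of_unit_norm (by linarith) h
    linarith
  refine ⟨ξ, hξ, fun i hi => ?_⟩
  rcases eq_or_ne i e with rfl | hie
  · simpa [hue] using hε
  have hi' : i ∈ S.erase e := Finset.mem_erase.2 ⟨hie, hi⟩
  have hsplit : (∑ j ∈ S, u j) ξ = (u i ξ + ξ) + ∑ j ∈ (S.erase e).erase i, u j ξ := by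
    rw [sum_apply, ← Finset.add_sum_erase S _ he, ← Finset.add_sum_erase _ _ hi', hue,
      one_apply_eq_self]
    abel
  have hrest : ‖∑ j ∈ (S.erase e).erase i, u j ξ‖ ≤ S.card - 2 := by
    refine (norm_sum_le _ _).trans ?_
    simp only [hu, hξ, Finset.sum_const, nsmul_eq_mul, mul_one]
    have h1 := Finset.card_erase_add_one hi'
    have h2 := Finset.card_erase_add_one he
    have h3 : (((S.erase e).erase i).card : ℝ) + 2 = S.card := by exact_mod_cast by omega
    linarith
  have hplus : 2 - η < ‖u i ξ + ξ‖ := by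
    rw [hsplit] at hlt
    linarith [norm_add_le (u i ξ + ξ) (∑ j ∈ (S.erase e).erase i, u j ξ)]
  have hpar := parallelogram_law_with_norm ℂ (u i ξ) ξ
  rw [hu, hξ] at hpar
  refine lt_of_pow_lt_pow_left₀ 2 hε.le ?_
  nlinarith

/-- The mass that the density `‖ξ‖²` gives to a set. -/
noncomputable def l2Mass {X : Type*} (ξ : ℓ²(X, ℂ)) (B : Set X) : ℝ :=
  ∑' x, B.indicator (fun x => ‖ξ x‖ ^ 2) x

theorem hasSum_norm_sq {X : Type*} (ξ : ℓ²(X, ℂ)) : HasSum (fun x => ‖ξ x‖ ^ 2) (‖ξ‖ ^ 2) := by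
  simpa using lp.hasSum_norm (p := 2) (by norm_num) ξ

theorem summable_l2Mass {X : Type*} (ξ : ℓ²(X, ℂ)) (B : Set X) :
    Summable (B.indicator fun x => ‖ξ x‖ ^ 2) :=
  (hasSum_norm_sq ξ).summable.indicator B

theorem l2Mass_univ {X : Type*} (ξ : ℓ²(X, ℂ)) : l2Mass ξ Set.univ = ‖ξ‖ ^ 2 := by
  simpa [l2Mass] using (hasSum_norm_sq ξ).tsum_eq

theorem l2Mass_nonneg {X : Type*} (ξ : ℓ²(X, ℂ)) (B : Set X) : 0 ≤ l2Mass ξ B :=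
  tsum_nonneg fun _ => Set.indicator_nonneg (fun _ _ => by positivity) _

theorem l2Mass_le {X : Type*} (ξ : ℓ²(X, ℂ)) (B : Set X) : l2Mass ξ B ≤ ‖ξ‖ ^ 2 :=
  hasSum_le (fun _ => Set.indicator_le_self' (fun _ _ => by positivity) _)
    (summable_l2Mass ξ B).hasSum (hasSum_norm_sq ξ)

theorem l2Mass_union {X : Type*} (ξ : ℓ²(X, ℂ)) {B C : Set X} (h : Disjoint B C) :
    l2Mass ξ (B ∪ C) = l2Mass ξ B + l2Mass ξ C := by
  rw [l2Mass, Set.indicator_union_of_disjoint h]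
  exact (summable_l2Mass ξ B).tsum_add (summable_l2Mass ξ C)

theorem l2Mass_permRep {X : Type*} (σ : Equiv.Perm X) (ξ : ℓ²(X, ℂ)) (B : Set X) :
    l2Mass (permRep X σ ξ) B = l2Mass ξ (σ ⁻¹' B) := by
  rw [l2Mass, ← Equiv.tsum_eq σ]
  refine tsum_congr fun x => ?_
  have : permRep X σ ξ (σ x) = ξ x := congrArg ξ (σ.symm_apply_apply x)
  simp only [Set.indicator, this]
  rfl

theorem abs_l2Mass_sub_le {X : Type*} (ξ η : ℓ²(X, ℂ)) (hξ : ‖ξ‖ = 1) (hη : ‖η‖ = 1) (B : Set X)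
    {δ : ℝ} (hδ : 0 < δ) (h : ‖ξ - η‖ ≤ δ) : |l2Mass ξ B - l2Mass η B| ≤ 3 * δ := by
  have hsum := ((hasSum_norm_sq (ξ - η)).mul_left δ⁻¹).add
    (((hasSum_norm_sq ξ).add (hasSum_norm_sq η)).mul_left δ)
  have hdiff : HasSum (fun x => B.indicator (fun x => ‖ξ x‖ ^ 2) x -
      B.indicator (fun x => ‖η x‖ ^ 2) x) (l2Mass ξ B - l2Mass η B) :=
    (summable_l2Mass ξ B).hasSum.sub (summable_l2Mass η B).hasSum
  -- The weighted arithmetic-geometric mean inequality for `(‖a‖ - ‖b‖) * (‖a‖ + ‖b‖)`.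
  have hpt : ∀ a b : ℂ, |‖a‖ ^ 2 - ‖b‖ ^ 2| ≤ δ⁻¹ * ‖a - b‖ ^ 2 + δ * (‖a‖ ^ 2 + ‖b‖ ^ 2) := by
    intro a b
    have h1 : |‖a‖ ^ 2 - ‖b‖ ^ 2| ≤ ‖a - b‖ * (‖a‖ + ‖b‖) := by
      rw [sq_sub_sq, abs_mul, mul_comm, abs_of_nonneg (add_nonneg (norm_nonneg a) (norm_nonneg b))]
      exact mul_le_mul_of_nonneg_right (abs_norm_sub_norm_le a b) (by positivity)
    refine h1.trans ?_
    rw [inv_mul_eq_div, ← sub_nonneg]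
    have h2 : ‖a - b‖ ^ 2 / δ + δ * (‖a‖ ^ 2 + ‖b‖ ^ 2) - ‖a - b‖ * (‖a‖ + ‖b‖) =
        ((‖a - b‖ - δ * (‖a‖ + ‖b‖) / 2) ^ 2 + δ ^ 2 * ((‖a‖ + ‖b‖) ^ 2 / 4
          + (‖a‖ - ‖b‖) ^ 2 / 2 )) / δ := by
      field_simp
      ring
    rw [h2]
    positivity
  have hbound : δ⁻¹ * ‖ξ - η‖ ^ 2 + δ * (‖ξ‖ ^ 2 + ‖η‖ ^ 2) ≤ 3 * δ := by
    have : δ⁻¹ * ‖ξ - η‖ ^ 2 ≤ δ := by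
      rw [inv_mul_le_iff₀ hδ, ← sq]
      exact pow_le_pow_left₀ (norm_nonneg _) h 2
    rw [hξ, hη]
    linarith
  have hind : ∀ x, |B.indicator (fun x => ‖ξ x‖ ^ 2) x - B.indicator (fun x => ‖η x‖ ^ 2) x| ≤
      δ⁻¹ * ‖(ξ - η) x‖ ^ 2 + δ * (‖ξ x‖ ^ 2 + ‖η x‖ ^ 2) := by
    intro x
    by_cases hx : x ∈ B
    · simpa [hx] using hpt (ξ x) (η x)
    · simp only [hx, not_false_eq_true, Set.indicator_of_notMem, sub_self, abs_zero]
      positivity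
  rw [abs_le]
  constructor
  · have := hasSum_le (fun x => (abs_le.1 (hind x)).1) hsum.neg hdiff
    linarith
  · exact (hasSum_le (fun x => (abs_le.1 (hind x)).2) hdiff hsum).trans hbound

/-- Almost invariant unit vectors in `ℓ²(X)` make the group amenable as soon as `X` maps
equivariantly to the group: a limit point of the densities `‖ξ‖²` is pushed forward. -/
theorem isAmenableGroup_of_almost_invariant {G X : Type*} [Group G] (σ : G → Equiv.Perm X)
    (f : X → G) (hf : ∀ g x, f (σ g x) = g * f x)
    (h : ∀ (S : Finset G) (ε : ℝ), 0 < ε →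
      ∃ ξ : ℓ²(X, ℂ), ‖ξ‖ = 1 ∧ ∀ g ∈ S, ‖permRep X (σ g) ξ - ξ‖ < ε) :
    IsAmenableGroup G := by
  classical
  choose ξ hξ hinv using fun i : Finset G × ℕ => h i.1 (1 / ((i.2 : ℝ) + 1)) (by positivity)
  let 𝒰 : Ultrafilter (Finset G × ℕ) := Ultrafilter.of atTop
  have hle : (𝒰 : Filter (Finset G × ℕ)) ≤ atTop := Ultrafilter.of_le _
  have hlim : ∀ A : Set G, ∃ l : ℝ, Tendsto (fun i => l2Mass (ξ i) (f ⁻¹' A)) 𝒰 (nhds l) := by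
    intro A
    obtain ⟨l, -, hl⟩ := (isCompact_Icc (a := (0 : ℝ)) (b := 1)).ultrafilter_le_nhds
      (𝒰.map fun i => l2Mass (ξ i) (f ⁻¹' A))
      (le_principal_iff.2 (Ultrafilter.mem_map.2 (univ_mem' fun i =>
        ⟨l2Mass_nonneg _ _, by simpa [hξ i] using l2Mass_le (ξ i) (f ⁻¹' A)⟩)))
    exact ⟨l, hl⟩
  choose m hm using hlim
  refine ⟨m, fun A => ge_of_tendsto' (hm A) fun i => l2Mass_nonneg _ _, ?_, fun A B hAB => ?_,
    fun g A => ?_⟩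
  · refine tendsto_nhds_unique (hm _) ?_
    simp [l2Mass_univ, hξ]
  · refine tendsto_nhds_unique (hm _) (((hm A).add (hm B)).congr fun i => ?_)
    rw [Set.preimage_union, l2Mass_union _ (hAB.preimage f)]
  · have hpre : σ g ⁻¹' (f ⁻¹' (g • A)) = f ⁻¹' A := by
      ext x
      simp [hf, Set.mem_smul_set_iff_inv_smul_mem]
    have hbound : ∀ᶠ i in (𝒰 : Filter (Finset G × ℕ)),
        ‖l2Mass (ξ i) (f ⁻¹' A) - l2Mass (ξ i) (f ⁻¹' (g • A))‖ ≤ 3 * (1 / ((i.2 : ℝ) + 1)) := by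
      refine hle ((eventually_ge_atTop ({g}, 0)).mono fun i hi => ?_)
      have hg : g ∈ i.1 := Finset.singleton_subset_iff.1 hi.1
      rw [← hpre, ← l2Mass_permRep]
      exact abs_l2Mass_sub_le _ _ (((permIsometry (σ g)).norm_map _).trans (hξ i)) (hξ i) _
        (by positivity) (hinv i g hg).le
    have hsmall : Tendsto (fun i : Finset G × ℕ => 3 * (1 / ((i.2 : ℝ) + 1))) 𝒰 (nhds 0) := by
      have h1 : Tendsto (fun i : Finset G × ℕ => i.2) 𝒰 atTop := by
        refine Tendsto.mono_left ?_ hle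
        rw [← prod_atTop_atTop_eq]
        exact tendsto_snd
      simpa using ((tendsto_one_div_add_atTop_nhds_zero_nat (𝕜 := ℝ)).comp h1).const_mul 3
    have h0 := squeeze_zero_norm' hbound hsmall
    exact (sub_eq_zero.1 (tendsto_nhds_unique ((hm A).sub (hm (g • A))) h0)).symm

/-! ### Inner amenable ICC groups -/

/-- In an ICC group, an inner-invariant mean that does not charge `1` charges no finite set, as the
points of an infinite conjugacy class have the same mass. -/
theorem IsICC.measure_ultrafilter_finite_eq_zero {G : Type*} [Group G] (hG : IsICC G)
    (μ : Measure (Ultrafilter G)) [IsFiniteMeasure μ] (h1 : μ {(pure 1 : Ultrafilter G)} = 0)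
    (hμ : ∀ g : G, μ.map (Ultrafilter.map fun x => g * x * g⁻¹) = μ) {F : Set G}
    (hF : F.Finite) : μ {U | F ∈ U} = 0 := by
  have hpt : ∀ x : G, μ {(pure x : Ultrafilter G)} = 0 := by
    intro x
    by_contra hx
    have hx1 : x ≠ 1 := by rintro rfl; exact hx h1
    refine hG x hx1 ?_
    have hfin := Measure.finite_const_le_meas_of_disjoint_iUnion μ (pos_iff_ne_zero.2 hx)
      (As := fun y : G => {(pure y : Ultrafilter G)}) (fun y => measurableSet_singleton _)
      (fun y z hyz => Set.disjoint_singleton.2 fun h => hyz (Ultrafilter.pure_injective h))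
      (measure_ne_top _ _)
    refine hfin.subset fun y hy => ?_
    obtain ⟨g, rfl⟩ := isConj_iff.1 hy
    change μ {pure x} ≤ μ {pure (g * x * g⁻¹)}
    have himage : μ (Ultrafilter.map (fun y => g * y * g⁻¹) ⁻¹' {pure (g * x * g⁻¹)}) =
        μ {(pure (g * x * g⁻¹) : Ultrafilter G)} := by
      rw [← Measure.map_apply (continuous_ultrafilter_map _).measurable
        (measurableSet_singleton _), hμ g]
    rw [← himage]
    exact measure_mono (Set.singleton_subset_iff.2 (Set.mem_singleton_iff.2
      (Ultrafilter.map_pure (fun y => g * y * g⁻¹) x)))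
  refine measure_mono_null (t := ⋃ x ∈ F, {(pure x : Ultrafilter G)}) (fun U hU => ?_)
    ((measure_biUnion_null_iff hF.countable).2 fun x _ => hpt x)
  obtain ⟨x, hx, rfl⟩ := Ultrafilter.eq_pure_of_finite_mem hF hU
  exact Set.mem_biUnion hx rfl

theorem mainTheorem1 (Γ : Type*) [Group Γ] [Countable Γ] (hICC : IsICC Γ)
    (hinner : IsInnerAmenable Γ) (hnonamenable : ¬ IsAmenableGroup Γ) :
    ¬ HasAOProperty Γ := by
  classical
  intro hAO
  obtain ⟨μ, hprob, -, h1, hμ⟩ := hinner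
  refine hnonamenable (isAmenableGroup_of_almost_invariant
    (fun g => MulAction.toPermHom (Γ × Γ) (Γ × Γ) (g, g)) Prod.fst (fun g x => rfl)
    fun S ε hε => ?_)
  let diag : Γ ↪ Γ × Γ := ⟨fun g => (g, g), fun g h hgh => congrArg Prod.fst hgh⟩
  -- The identity is added to `S` so that the almost equal vectors `λ (g, g) ξ` are almost `ξ`.
  have hcard := IsTempered.card_le_norm_sum hAO ((insert 1 S).map diag) fun F δ hδ => by
    obtain ⟨ξ, hξ, hξF, hinv⟩ := exists_almost_invariant_unit_vector μ
      (fun g : (insert 1 S : Finset Γ) => leftRightPerm Γ (diag g)) (fun g => hμ g)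
      (hICC.measure_ultrafilter_finite_eq_zero μ h1 hμ F.finite_toSet) hδ
    refine ⟨ξ, hξ, hξF, fun p hp => ?_⟩
    obtain ⟨g, hg, rfl⟩ := Finset.mem_map.1 hp
    exact hinv ⟨g, hg⟩
  obtain ⟨ξ, hξ, hinv⟩ := exists_almost_fixed_unit_vector ((insert 1 S).map diag)
    (leftRegular (Γ × Γ)) (fun p ξ => (permIsometry _).norm_map ξ)
    (Finset.mem_map_of_mem diag (Finset.mem_insert_self 1 S)) (map_one (leftRegular (Γ × Γ)))
    hcard hε
  exact ⟨ξ, hξ, fun g hg => hinv _ (Finset.mem_map_of_mem diag (Finset.mem_insert_of_mem hg))⟩
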